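/- Let $d\ge 0$ be an integer and let $P\subset\mathbb{R}^d$ be a two-dimensional lattice polytope (a lattice polygon), that is, a convex polytope whose affine hull has dimension $2$ and whose vertices all lie in $\mathbb{Z}^d$. Then there is exactly one polynomial $i_P\in\mathbb{C}[t]$ (the Ehrhart polynomial of $P$) such that $i_P(n)=\#(nP\cap\mathbb{Z}^d)$ for all integers $n\ge 0$, and every complex root of $i_P$ is contained in \[ \left\{-2,\,-1,\,-\tfrac23\right\}\ \cup\ \left\{x+iy\in\mathbb{C} : -\tfrac12\le x<0,\ |y|\le \tfrac{\sqrt{15}}{6}\right\}. \] -/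

import Mathlib

open scoped Pointwise

/-- The point of `ℝ^d` given by an integer vector. -/
def intPoint {d : ℕ} (z : Fin d → ℤ) : Fin d → ℝ := fun i => (z i : ℝ)

/-- A lattice polytope in `ℝ^d`: a convex polytope (the convex hull of finitely many points)
all of whose vertices (extreme points) have integral coordinates. -/
def IsLatticePolytope {d : ℕ} (P : Set (Fin d → ℝ)) : Prop :=
  (∃ S : Set (Fin d → ℝ), S.Finite ∧ P = convexHull ℝ S) ∧
    ∀ v ∈ P.extremePoints ℝ, ∃ z : Fin d → ℤ, v = intPoint z

/-- The dimension of a nonempty polytope: the dimension of its affine hull. -/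
noncomputable def polytopeDim {d : ℕ} (P : Set (Fin d → ℝ)) : ℕ :=
  Module.finrank ℝ (vectorSpan ℝ P)

/-- The number of lattice points in the `n`-fold dilate of `P`. -/
noncomputable def latticePointCount {d : ℕ} (P : Set (Fin d → ℝ)) (n : ℕ) : ℕ :=
  {z : Fin d → ℤ | intPoint z ∈ (n : ℝ) • P}.ncard

/-- `p` is the Ehrhart polynomial of `P`: at every natural number `n` it takes the number of
lattice points of `n P` as its value. -/
def IsEhrhartPolynomial {d : ℕ} (P : Set (Fin d → ℝ)) (p : Polynomial ℂ) : Prop :=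
  ∀ n : ℕ, p.eval (n : ℂ) = (latticePointCount P n : ℂ)

/-!
In coordinates of the lattice cut out by its affine hull, `P` becomes a lattice polygon in the
plane, the region between a convex function `l` and a concave function `u` over an interval. Along
a side of rational slope the floors of the height form an arithmetic progression up to a periodic
term symmetric under reflection, so their sum is quadratic in the dilation factor; summing over the
sides yields Pick's theorem and the Ehrhart polynomial `(i + k / 2 - 1) t² + (k / 2) t + 1`, with
`i` interior and `k` boundary points.

Scott's inequality `i = 0 ∨ k ≤ 2 i + 6 ∨ (k = 9 ∧ i = 1)` comes from a unimodular image of least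
width: a shear makes some transversal of the polygon nearly horizontal, while minimality provides
two vertices far apart in the vertical direction, and the quadrilateral they span with the
transversal has large area. In each of the three cases the roots of the quadratic are located
directly.
-/

/-- The floor shifted by one half, so that a column `l ≤ t ≤ u` of a polygon contains exactly
`midFloor u + midFloor (-l)` integers `t`. -/
noncomputable def midFloor (x : ℝ) : ℝ := ⌊x⌋ + 1 / 2

theorem midFloor_intCast_add (m : ℤ) (x : ℝ) : midFloor (m + x) = m + midFloor x := by
  rw [midFloor, midFloor, Int.floor_intCast_add, Int.cast_add, add_assoc]

open Classical in
theorem midFloor_add_midFloor_neg (x : ℝ) :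
    midFloor x + midFloor (-x) = if x ∈ Set.range ((↑) : ℤ → ℝ) then 1 else 0 := by
  rw [midFloor, midFloor, Int.floor_neg]
  split_ifs with hx
  · obtain ⟨m, rfl⟩ := hx
    rw [Int.floor_intCast, Int.ceil_intCast]
    push_cast
    ring
  · rw [Int.ceil_eq_floor_add_one_iff_notMem x |>.mpr hx]
    push_cast
    ring

open Classical in
/-- The number of integers in `[a, b)` at which `g` takes an integral value. -/
noncomputable def integralCount (g : ℝ → ℝ) (a b : ℤ) : ℕ :=
  {x ∈ Finset.Ico a b | g (x : ℤ) ∈ Set.range ((↑) : ℤ → ℝ)}.card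

theorem cast_integralCount (g : ℝ → ℝ) (a b : ℤ) :
    (integralCount g a b : ℝ) = ∑ x ∈ Finset.Ico a b, (midFloor (g x) + midFloor (-g x)) := by
  simp_rw [midFloor_add_midFloor_neg]
  rw [integralCount, Finset.sum_boole]

theorem sum_range_mul_of_periodic {f : ℕ → ℝ} {q : ℕ} (hf : Function.Periodic f q) (n : ℕ) :
    ∑ j ∈ Finset.range (n * q), f j = n * ∑ j ∈ Finset.range q, f j := by
  induction n with
  | zero => simp
  | succ n ih =>
    have hshift (j : ℕ) : f (n * q + j) = f j := by
      rw [add_comm]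
      exact hf.nat_mul n j
    rw [Nat.succ_mul, Finset.sum_range_add, ih, Finset.sum_congr rfl fun j _ => hshift j]
    push_cast
    ring

theorem two_mul_sum_midFloor_mul {α : ℝ} {N : ℕ} {M : ℤ} (hα : N * α = M) :
    2 * ∑ j ∈ Finset.range N, midFloor (j * α) =
      (N - 1) * M + ∑ j ∈ Finset.range N, (midFloor (j * α) + midFloor (-(j * α))) := by
  have hreflect : ∑ j ∈ Finset.range N, midFloor ((N - j : ℕ) * α) =
      N * M + ∑ j ∈ Finset.range N, midFloor (-(j * α)) := by
    have hterm : ∀ j ∈ Finset.range N,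
        midFloor ((N - j : ℕ) * α) = M + midFloor (-(j * α)) := fun j hj => by
      rw [Nat.cast_sub (Finset.mem_range.mp hj).le, ← midFloor_intCast_add, ← hα, sub_mul,
        sub_eq_add_neg]
    rw [Finset.sum_congr rfl hterm, Finset.sum_add_distrib]
    simp
  have hshift : ∑ j ∈ Finset.range N, midFloor ((N - j : ℕ) * α) =
      ∑ j ∈ Finset.range N, midFloor (j * α) + M := by
    have hends := (Finset.sum_range_succ' (fun j : ℕ => midFloor (j * α)) N).symm.trans
      (Finset.sum_range_succ _ N)
    have hN : midFloor (N * α) = M + midFloor ((0 : ℕ) * α) := by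
      rw [hα, ← midFloor_intCast_add]
      simp
    rw [← Finset.sum_range_reflect (fun j : ℕ => midFloor ((j + 1 : ℕ) * α))] at hends
    have hcongr : ∀ j ∈ Finset.range N, midFloor ((N - 1 - j + 1 : ℕ) * α) =
        midFloor ((N - j : ℕ) * α) := fun j hj => by
      rw [show N - 1 - j + 1 = N - j by have := Finset.mem_range.mp hj; omega]
    rw [Finset.sum_congr rfl hcongr] at hends
    linarith
  rw [Finset.sum_add_distrib]
  linarith

theorem sum_Ico_add_natCast {M : Type*} [AddCommMonoid M] (f : ℤ → M) (a : ℤ) (q : ℕ) :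
    ∑ x ∈ Finset.Ico a (a + q), f x = ∑ j ∈ Finset.range q, f (a + j) := by
  rw [Int.Ico_eq_finset_map, Finset.sum_map]
  simp

theorem sum_Ico_add_sum_Ico {M : Type*} [AddCommMonoid M] (f : ℤ → M) {a b c : ℤ}
    (hab : a ≤ b) (hbc : b ≤ c) :
    ∑ x ∈ Finset.Ico a b, f x + ∑ x ∈ Finset.Ico b c, f x = ∑ x ∈ Finset.Ico a c, f x := by
  rw [← Finset.Ico_union_Ico_eq_Ico hab hbc,
    Finset.sum_union (Finset.Ico_disjoint_Ico_consecutive a b c)]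

theorem cast_integralCount_affine (x₀ a : ℤ) (α : ℝ) (q : ℕ) :
    (integralCount (fun t => x₀ + (t - a) * α) a (a + q) : ℝ) =
      ∑ j ∈ Finset.range q, (midFloor (j * α) + midFloor (-(j * α))) := by
  rw [cast_integralCount, sum_Ico_add_natCast]
  refine Finset.sum_congr rfl fun j _ => ?_
  push_cast
  rw [add_sub_cancel_left, neg_add, ← Int.cast_neg, midFloor_intCast_add, midFloor_intCast_add]
  push_cast
  ring

theorem integral_affine (x₀ α a b : ℝ) :
    ∫ t in a..b, (x₀ + (t - a) * α) = (b - a) * (x₀ + (x₀ + (b - a) * α)) / 2 := by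
  rw [intervalIntegral.integral_add (by simp)
      (Continuous.intervalIntegrable (by fun_prop) _ _), intervalIntegral.integral_mul_const,
    intervalIntegral.integral_comp_sub_right (fun t => t), integral_id,
    intervalIntegral.integral_const, smul_eq_mul]
  ring

/-- The sums of `midFloor` over the dilates of the graph of `g` above `[a, b)` are quadratic in the
dilation factor, with the coefficients that a side of a lattice polygon has. -/
def HasFloorSum (g : ℝ → ℝ) (a b : ℤ) : Prop :=
  IntervalIntegrable g MeasureTheory.volume a b ∧
    ∀ n : ℕ, ∑ x ∈ Finset.Ico (n * a) (n * b), midFloor (n * g (x / n)) =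
      n ^ 2 * (∫ t in (a : ℝ)..b, g t) - n * (g b - g a) / 2 + n * integralCount g a b / 2

namespace HasFloorSum

theorem trans {g : ℝ → ℝ} {a b c : ℤ} (hab : a ≤ b) (hbc : b ≤ c)
    (h₁ : HasFloorSum g a b) (h₂ : HasFloorSum g b c) : HasFloorSum g a c := by
  refine ⟨h₁.1.trans h₂.1, fun n => ?_⟩
  have hn : (0 : ℤ) ≤ n := by positivity
  rw [← sum_Ico_add_sum_Ico _ (mul_le_mul_of_nonneg_left hab hn)
    (mul_le_mul_of_nonneg_left hbc hn), h₁.2, h₂.2,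
    ← intervalIntegral.integral_add_adjacent_intervals h₁.1 h₂.1]
  simp only [cast_integralCount]
  rw [← sum_Ico_add_sum_Ico _ hab hbc]
  ring

theorem congr {f g : ℝ → ℝ} {a b : ℤ} (hab : a ≤ b) (hf : HasFloorSum f a b)
    (hfg : Set.EqOn f g (Set.Icc a b)) : HasFloorSum g a b := by
  have habR : (a : ℝ) ≤ b := by exact_mod_cast hab
  refine ⟨hf.1.congr fun t ht => hfg ?_, fun n => ?_⟩
  · rw [Set.uIoc_of_le habR] at ht
    exact ⟨ht.1.le, ht.2⟩
  have hcount : (integralCount g a b : ℝ) = integralCount f a b := by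
    simp only [cast_integralCount]
    refine Finset.sum_congr rfl fun x hx => ?_
    obtain ⟨hax, hxb⟩ := Finset.mem_Ico.mp hx
    rw [hfg ⟨by exact_mod_cast hax, by exact_mod_cast hxb.le⟩]
  have hint : ∫ t in (a : ℝ)..b, g t = ∫ t in (a : ℝ)..b, f t :=
    intervalIntegral.integral_congr fun t ht => (hfg (by rwa [Set.uIcc_of_le habR] at ht)).symm
  rw [hcount, hint, ← hfg ⟨le_rfl, habR⟩, ← hfg ⟨habR, le_rfl⟩, ← hf.2 n]
  refine Finset.sum_congr rfl fun x hx => ?_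
  obtain ⟨hax, hxb⟩ := Finset.mem_Ico.mp hx
  have hn : (0 : ℝ) < n := by
    rcases n.eq_zero_or_pos with rfl | hn
    · simp only [Nat.cast_zero, zero_mul] at hax hxb
      omega
    · exact_mod_cast hn
  rw [hfg ⟨(le_div_iff₀ hn).mpr (by rw [mul_comm]; exact_mod_cast hax),
    (div_le_iff₀ hn).mpr (by rw [mul_comm]; exact_mod_cast hxb.le)⟩]

theorem affine (x₀ a : ℤ) {α : ℝ} {q : ℕ} {m : ℤ} (hα : q * α = m) :
    HasFloorSum (fun t => x₀ + (t - a) * α) a (a + q) := by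
  refine ⟨Continuous.intervalIntegrable (by fun_prop) _ _, fun n => ?_⟩
  have hcolumn : ∀ j ∈ Finset.range (n * q),
      midFloor (n * (x₀ + ((n * a + j : ℤ) / n - a) * α)) = n * x₀ + midFloor (j * α) := by
    intro j hj
    have hn : (n : ℝ) ≠ 0 := by
      rintro h
      simp [Nat.cast_eq_zero.mp h] at hj
    rw [show (n : ℝ) * x₀ = (n * x₀ : ℤ) by push_cast; rfl, ← midFloor_intCast_add]
    congr 1
    push_cast
    field_simp
    ring
  have hperiodic : Function.Periodic
      (fun j : ℕ => midFloor (j * α) + midFloor (-(j * α))) q := fun j => by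
    have hneg : -((j + q : ℕ) * α) = (-m : ℤ) + -(j * α) := by
      push_cast
      linear_combination -hα
    have hpos : (j + q : ℕ) * α = m + j * α := by
      push_cast
      linear_combination hα
    simp only
    rw [hneg, hpos, midFloor_intCast_add, midFloor_intCast_add]
    push_cast
    ring
  have hsum := two_mul_sum_midFloor_mul (α := α) (N := n * q) (M := n * m)
    (by push_cast; rw [mul_assoc, hα])
  rw [sum_range_mul_of_periodic hperiodic, ← cast_integralCount_affine x₀ a] at hsum
  rw [show (n : ℤ) * (a + q) = n * a + (n * q : ℕ) by push_cast; ring, sum_Ico_add_natCast,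
    Finset.sum_congr rfl hcolumn, Finset.sum_add_distrib, Finset.sum_const, Finset.card_range,
    nsmul_eq_mul, integral_affine]
  push_cast at hsum ⊢
  linear_combination hsum / 2 - n * (n * q - 1) / 2 * hα

end HasFloorSum

theorem intPoint_injective {d : ℕ} : Function.Injective (intPoint (d := d)) := fun _ _ h =>
  funext fun i => Int.cast_injective (congrFun h i)

theorem intPoint_add {d : ℕ} (z w : Fin d → ℤ) : intPoint (z + w) = intPoint z + intPoint w :=
  funext fun _ => Int.cast_add _ _

theorem latticePointCount_eq_ncard {d : ℕ} (P : Set (Fin d → ℝ)) (n : ℕ) :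
    latticePointCount P n = ((n : ℝ) • P ∩ Set.range intPoint).ncard := by
  rw [← Set.image_preimage_eq_inter_range, Set.ncard_image_of_injective _ intPoint_injective]
  rfl

theorem latticePointCount_zero {d : ℕ} {P : Set (Fin d → ℝ)} (hP : P.Nonempty) :
    latticePointCount P 0 = 1 := by
  have hzero : (0 : Fin d → ℝ) ∈ Set.range intPoint := ⟨0, funext fun _ => Int.cast_zero⟩
  rw [latticePointCount_eq_ncard, Nat.cast_zero, Set.zero_smul_set hP, ← Set.singleton_zero,
    Set.inter_eq_left.mpr (Set.singleton_subset_iff.mpr hzero), Set.ncard_singleton]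

theorem latticePointCount_intPoint_vadd {d : ℕ} (z₀ : Fin d → ℤ) (P : Set (Fin d → ℝ)) (n : ℕ) :
    latticePointCount (intPoint z₀ +ᵥ P) n = latticePointCount P n := by
  have hshift : (n : ℝ) • (intPoint z₀ +ᵥ P) ∩ Set.range intPoint =
      intPoint (n • z₀) +ᵥ ((n : ℝ) • P ∩ Set.range intPoint) := by
    have hdilate : intPoint (n • z₀) = (n : ℝ) • intPoint z₀ := by
      ext i
      simp [intPoint]
    have hrange : intPoint (n • z₀) +ᵥ Set.range (intPoint (d := d)) = Set.range intPoint := by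
      rw [← Set.image_vadd, ← Set.range_comp]
      refine ((Equiv.addLeft (n • z₀)).surjective.range_comp intPoint).symm.trans ?_ |>.symm
      exact congrArg Set.range (funext fun z => intPoint_add _ _)
    rw [Set.vadd_set_inter, hrange, hdilate, ← Set.singleton_vadd, ← Set.singleton_vadd]
    simp only [vadd_eq_add, smul_add, Set.smul_set_singleton]
  rw [latticePointCount_eq_ncard, latticePointCount_eq_ncard, hshift, ← Set.image_vadd,
    Set.ncard_image_of_injective _ (AddAction.injective _)]

theorem polytopeDim_vadd {d : ℕ} (x : Fin d → ℝ) (P : Set (Fin d → ℝ)) :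
    polytopeDim (x +ᵥ P) = polytopeDim P := by
  rw [polytopeDim, vectorSpan_vadd, polytopeDim]

/-- An injective linear map under which the integer points of the source correspond to the integer
points of its range: an isomorphism of `ℤ^m` onto a saturated sublattice of `ℤ^d`. -/
structure IsLatticeEmbedding {m d : ℕ} (φ : (Fin m → ℝ) →ₗ[ℝ] (Fin d → ℝ)) : Prop where
  injective : Function.Injective φ
  mem_range_iff : ∀ x, φ x ∈ Set.range intPoint ↔ x ∈ Set.range intPoint

namespace IsLatticeEmbedding

variable {m d : ℕ} {φ : (Fin m → ℝ) →ₗ[ℝ] (Fin d → ℝ)}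

theorem latticePointCount_image (hφ : IsLatticeEmbedding φ) (P : Set (Fin m → ℝ)) (n : ℕ) :
    latticePointCount (φ '' P) n = latticePointCount P n := by
  have hpreimage : φ ⁻¹' Set.range intPoint = Set.range intPoint := Set.ext hφ.mem_range_iff
  rw [latticePointCount_eq_ncard, latticePointCount_eq_ncard, ← image_smul_set,
    ← Set.image_inter_preimage, hpreimage, Set.ncard_image_of_injective _ hφ.injective]

theorem polytopeDim_image (hφ : IsLatticeEmbedding φ) (P : Set (Fin m → ℝ)) :
    polytopeDim (φ '' P) = polytopeDim P := by
  have hspan := AffineMap.map_vectorSpan (f := φ.toAffineMap) (s := P)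
  rw [polytopeDim, polytopeDim, ← LinearMap.coe_toAffineMap, ← hspan]
  exact (Submodule.equivMapOfInjective φ hφ.injective _).finrank_eq.symm

end IsLatticeEmbedding

theorem toLin'_intPoint {m : ℕ} (M : Matrix (Fin m) (Fin m) ℤ) (v : Fin m → ℤ) :
    Matrix.toLin' (M.map ((↑) : ℤ → ℝ)) (intPoint v) = intPoint (M.mulVec v) := by
  ext i
  simp only [Matrix.toLin'_apply]
  exact (RingHom.map_mulVec (Int.castRingHom ℝ) M v i).symm

theorem isLatticeEmbedding_toLin' {m : ℕ} {M : Matrix (Fin m) (Fin m) ℤ} (hM : IsUnit M.det) :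
    IsLatticeEmbedding (Matrix.toLin' (M.map ((↑) : ℤ → ℝ))) := by
  have hinjective : Function.Injective (Matrix.toLin' (M.map ((↑) : ℤ → ℝ))) :=
    Matrix.mulVec_injective_of_isUnit
      (((Matrix.isUnit_iff_isUnit_det M).mpr hM).map (Int.castRingHom ℝ).mapMatrix)
  refine ⟨hinjective, fun x => ⟨?_, ?_⟩⟩
  · rintro ⟨w, hw⟩
    refine ⟨M⁻¹.mulVec w, hinjective ?_⟩
    rw [toLin'_intPoint, Matrix.mulVec_mulVec, Matrix.mul_nonsing_inv M hM, Matrix.one_mulVec, hw]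
  · rintro ⟨v, rfl⟩
    exact ⟨_, (toLin'_intPoint M v).symm⟩

/-- The lattice polytope spanned by finitely many integer vectors. -/
def latticeHull {d : ℕ} (V : Finset (Fin d → ℤ)) : Set (Fin d → ℝ) :=
  convexHull ℝ (intPoint '' V)

section latticeHull

variable {d : ℕ} {V : Finset (Fin d → ℤ)}

theorem intPoint_mem_latticeHull {v : Fin d → ℤ} (hv : v ∈ V) : intPoint v ∈ latticeHull V :=
  subset_convexHull ℝ _ (Set.mem_image_of_mem _ hv)

theorem isCompact_latticeHull (V : Finset (Fin d → ℤ)) : IsCompact (latticeHull V) :=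
  (V.finite_toSet.image _).isCompact_convexHull ℝ

theorem le_of_mem_latticeHull (f : (Fin d → ℝ) →ₗ[ℝ] ℝ) {c : ℝ}
    (hf : ∀ v ∈ V, f (intPoint v) ≤ c) {x : Fin d → ℝ} (hx : x ∈ latticeHull V) : f x ≤ c :=
  convexHull_min (t := {x | f x ≤ c}) (Set.image_subset_iff.mpr hf)
    (convex_halfSpace_le f.isLinear c) hx

theorem exists_le_apply_of_mem_latticeHull (f : (Fin d → ℝ) →ₗ[ℝ] ℝ) {x : Fin d → ℝ}
    (hx : x ∈ latticeHull V) : ∃ v ∈ V, f x ≤ f (intPoint v) := by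
  by_contra! hV
  exact lt_irrefl (f x) (convexHull_min (t := {y | f y < f x}) (Set.image_subset_iff.mpr hV)
    (convex_halfSpace_lt f.isLinear _) hx)

theorem exists_apply_ne_of_polytopeDim_eq (hdim : polytopeDim (latticeHull V) = d)
    {f : (Fin d → ℝ) →ₗ[ℝ] ℝ} (hf : f ≠ 0) (c : ℝ) : ∃ v ∈ V, f (intPoint v) ≠ c := by
  by_contra! hV
  have hhyperplane : latticeHull V ⊆ {x | f x = c} :=
    convexHull_min (Set.image_subset_iff.mpr hV) (convex_hyperplane f.isLinear c)
  have htop : vectorSpan ℝ (latticeHull V) = ⊤ :=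
    Submodule.eq_top_of_finrank_eq (by rw [Module.finrank_fin_fun]; exact hdim)
  have hker : vectorSpan ℝ (latticeHull V) ≤ LinearMap.ker f := Submodule.span_le.mpr <| by
    rintro _ ⟨x, hx, y, hy, rfl⟩
    exact LinearMap.sub_mem_ker_iff.mpr ((hhyperplane hx).trans (hhyperplane hy).symm)
  exact hf (LinearMap.ker_eq_top.mp (top_le_iff.mp (htop ▸ hker)))

theorem toLin'_image_latticeHull (M : Matrix (Fin d) (Fin d) ℤ) (V : Finset (Fin d → ℤ)) :
    Matrix.toLin' (M.map ((↑) : ℤ → ℝ)) '' latticeHull V =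
      latticeHull (V.image M.mulVec) := by
  rw [latticeHull, latticeHull, LinearMap.image_convexHull, Finset.coe_image, Set.image_image,
    Set.image_image]
  simp only [toLin'_intPoint]

theorem vectorSpan_latticeHull_of_zero_mem (hV : 0 ∈ V) :
    vectorSpan ℝ (latticeHull V) = Submodule.span ℝ (intPoint '' (V : Set (Fin d → ℤ))) := by
  have hzero : (0 : Fin d → ℝ) ∈ intPoint '' (V : Set (Fin d → ℤ)) :=
    ⟨0, hV, funext fun _ => Int.cast_zero⟩
  rw [latticeHull, ← direction_affineSpan, affineSpan_convexHull, direction_affineSpan,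
    vectorSpan_eq_span_vsub_set_right ℝ hzero]
  simp

theorem latticeHull_image_add_left (z : Fin d → ℤ) (V : Finset (Fin d → ℤ)) :
    latticeHull (V.image (z + ·)) = intPoint z +ᵥ latticeHull V := by
  rw [latticeHull, latticeHull, ← convexHull_vadd, Finset.coe_image, ← Set.image_vadd,
    Set.image_image, Set.image_image]
  simp only [intPoint_add, vadd_eq_add]

end latticeHull

theorem equivFun_symm_mem_span_iff {m : ℕ} {E : Type*} [AddCommGroup E] [Module ℝ E]
    (B : Module.Basis (Fin m) ℝ E) (x : Fin m → ℝ) :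
    B.equivFun.symm x ∈ Submodule.span ℤ (Set.range B) ↔ x ∈ Set.range intPoint := by
  have hrepr (i : Fin m) : B.repr (B.equivFun.symm x) i = x i :=
    congrFun (B.equivFun.apply_symm_apply x) i
  simp only [Module.Basis.mem_span_iff_repr_mem, hrepr]
  refine ⟨fun h => ?_, ?_⟩
  · choose z hz using h
    exact ⟨z, funext hz⟩
  · rintro ⟨z, rfl⟩ i
    exact ⟨z i, rfl⟩

theorem exists_isLatticeEmbedding_range_eq {d : ℕ} {S : Set (Fin d → ℝ)}
    (hS : S ⊆ Set.range intPoint) :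
    ∃ φ : (Fin (Module.finrank ℝ (Submodule.span ℝ S)) → ℝ) →ₗ[ℝ] (Fin d → ℝ),
      IsLatticeEmbedding φ ∧ LinearMap.range φ = Submodule.span ℝ S := by
  set E := Submodule.span ℝ S
  let L₀ : Submodule ℤ (Fin d → ℝ) := Submodule.span ℤ (Set.range (Pi.basisFun ℝ (Fin d)))
  have hL₀ (x : Fin d → ℝ) : x ∈ L₀ ↔ x ∈ Set.range intPoint :=
    equivFun_symm_mem_span_iff (Pi.basisFun ℝ (Fin d)) x
  let L : Submodule ℤ E := ZLattice.comap ℝ L₀ E.subtype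
  have : DiscreteTopology L :=
    ZLattice.comap_discreteTopology ℝ L₀ continuous_subtype_val Subtype.val_injective
  have : IsZLattice ℝ L := ⟨by
    rw [← top_le_iff, ← Submodule.map_le_map_iff_of_injective E.injective_subtype,
      Submodule.map_subtype_top, Submodule.map_span]
    refine Submodule.span_mono fun x hx => ?_
    exact ⟨⟨x, Submodule.subset_span hx⟩, (hL₀ x).mpr (hS hx), rfl⟩⟩
  have : Module.Finite ℤ L := ZLattice.module_finite ℝ L
  have : Module.Free ℤ L := ZLattice.module_free ℝ L
  let B := (Module.finBasisOfFinrankEq ℤ L (ZLattice.rank ℝ L)).ofZLatticeBasis ℝ L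
  have hB : Submodule.span ℤ (Set.range B) = L := Module.Basis.ofZLatticeBasis_span ℝ L _
  refine ⟨E.subtype ∘ₗ B.equivFun.symm.toLinearMap,
    ⟨Subtype.val_injective.comp B.equivFun.symm.injective, fun x => ?_⟩, ?_⟩
  · rw [← equivFun_symm_mem_span_iff B, hB]
    exact (hL₀ _).symm
  · rw [LinearMap.range_comp, LinearEquiv.range, Submodule.map_top, Submodule.range_subtype]

theorem exists_isLatticeEmbedding_image_eq {d : ℕ} {V : Finset (Fin d → ℤ)} (hV : 0 ∈ V) :
    ∃ φ : (Fin (polytopeDim (latticeHull V)) → ℝ) →ₗ[ℝ] (Fin d → ℝ), IsLatticeEmbedding φ ∧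
      ∃ W, φ '' latticeHull W = latticeHull V := by
  classical
  rw [polytopeDim, vectorSpan_latticeHull_of_zero_mem hV]
  obtain ⟨φ, hφ, hrange⟩ := exists_isLatticeEmbedding_range_eq
    (Set.image_subset_range intPoint (V : Set (Fin d → ℤ)))
  have hcoordinates : ∀ v ∈ V, ∃ w, φ (intPoint w) = intPoint v := fun v hv => by
    have hmem : intPoint v ∈ LinearMap.range φ := by
      rw [hrange]
      exact Submodule.subset_span (Set.mem_image_of_mem _ hv)
    obtain ⟨x, hx⟩ := hmem
    obtain ⟨w, rfl⟩ := (hφ.mem_range_iff x).mp ⟨v, hx.symm⟩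
    exact ⟨w, hx⟩
  choose! f hf using hcoordinates
  refine ⟨φ, hφ, V.image f, ?_⟩
  rw [latticeHull, latticeHull, LinearMap.image_convexHull, Finset.coe_image, Set.image_image,
    Set.image_image, Set.image_congr hf]

namespace IsLatticePolytope

variable {d : ℕ} {P : Set (Fin d → ℝ)}

theorem exists_eq_latticeHull (hP : IsLatticePolytope P) :
    ∃ V : Finset (Fin d → ℤ), P = latticeHull V := by
  obtain ⟨⟨T, hT, rfl⟩, hvertices⟩ := hP
  have hfinite : ((convexHull ℝ T).extremePoints ℝ).Finite :=
    hT.subset extremePoints_convexHull_subset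
  have hKreinMilman :=
    closure_convexHull_extremePoints (hT.isCompact_convexHull ℝ) (convex_convexHull ℝ T)
  rw [(hfinite.isClosed_convexHull ℝ).closure_eq] at hKreinMilman
  have himage : intPoint '' (intPoint ⁻¹' (convexHull ℝ T).extremePoints ℝ) =
      (convexHull ℝ T).extremePoints ℝ :=
    Set.image_preimage_eq_iff.mpr fun v hv => (hvertices v hv).imp fun _ => Eq.symm
  refine ⟨(hfinite.preimage intPoint_injective.injOn).toFinset, ?_⟩
  rw [latticeHull, Set.Finite.coe_toFinset, himage, hKreinMilman]

theorem exists_latticeHull_latticePointCount_eq (hP : IsLatticePolytope P) (hne : P.Nonempty) :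
    ∃ V : Finset (Fin (polytopeDim P) → ℤ), polytopeDim (latticeHull V) = polytopeDim P ∧
      latticePointCount (latticeHull V) = latticePointCount P := by
  classical
  obtain ⟨U, rfl⟩ := hP.exists_eq_latticeHull
  obtain ⟨_, z₀, hz₀, rfl⟩ := convexHull_nonempty_iff.mp hne
  have hzero : 0 ∈ U.image (-z₀ + ·) :=
    Finset.mem_image.mpr ⟨z₀, hz₀, neg_add_cancel z₀⟩
  have hdim : polytopeDim (latticeHull (U.image (-z₀ + ·))) = polytopeDim (latticeHull U) := by
    rw [latticeHull_image_add_left, polytopeDim_vadd]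
  obtain ⟨φ, hφ, W, hW⟩ := exists_isLatticeEmbedding_image_eq hzero
  rw [← hdim]
  refine ⟨W, ?_, funext fun n => ?_⟩
  · rw [← hφ.polytopeDim_image, hW]
  · rw [← hφ.latticePointCount_image, hW, latticeHull_image_add_left,
      latticePointCount_intPoint_vadd]

end IsLatticePolytope

section Concave

variable {g : ℝ → ℝ} {a b : ℝ}

theorem three_point_of_concaveOn {s : Set ℝ} (hg : ConcaveOn ℝ s g) {x y z : ℝ}
    (hx : x ∈ s) (hz : z ∈ s) (hxy : x ≤ y) (hyz : y ≤ z) :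
    (z - y) * g x + (y - x) * g z ≤ (z - x) * g y := by
  rcases hxy.eq_or_lt with rfl | hxy
  · linarith
  rcases hyz.eq_or_lt with rfl | hyz
  · linarith
  have hsecant := hg.neg.secant_mono_aux1 hx hz hxy hyz
  simp only [Pi.neg_apply] at hsecant
  linarith

theorem chord_le_of_concaveOn (hg : ConcaveOn ℝ (Set.Icc a b) g) {t α : ℝ}
    (ht : t ∈ Set.Icc a b) (hα : (b - a) * α = g b - g a) : g a + (t - a) * α ≤ g t := by
  have hab := ht.1.trans ht.2
  rcases hab.eq_or_lt with rfl | hlt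
  · obtain rfl := le_antisymm ht.2 ht.1
    simp
  have hthree := three_point_of_concaveOn hg ⟨le_rfl, hab⟩ ⟨hab, le_rfl⟩ ht.1 ht.2
  refine le_of_mul_le_mul_left ?_ (sub_pos.mpr hlt)
  linear_combination hthree + (t - a) * hα

theorem pos_of_concaveOn (hg : ConcaveOn ℝ (Set.Icc a b) g) (ha : 0 ≤ g a) (hb : 0 ≤ g b) {s t : ℝ}
    (hs : s ∈ Set.Icc a b) (hpos : 0 < g s) (ht : t ∈ Set.Ioo a b) : 0 < g t := by
  have hab := ht.1.trans ht.2
  rcases le_total s t with hst | hts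
  · have hthree := three_point_of_concaveOn hg hs ⟨hab.le, le_rfl⟩ hst ht.2.le
    have hleft : 0 < (b - t) * g s := mul_pos (sub_pos.mpr ht.2) hpos
    have hright : 0 ≤ (t - s) * g b := mul_nonneg (sub_nonneg.mpr hst) hb
    exact pos_of_mul_pos_right (hthree.trans_lt' (by linarith)) (sub_nonneg.mpr hs.2)
  · have hthree := three_point_of_concaveOn hg ⟨le_rfl, hab.le⟩ hs ht.1.le hts
    have hleft : 0 ≤ (s - t) * g a := mul_nonneg (sub_nonneg.mpr hts) ha
    have hright : 0 < (t - a) * g s := mul_pos (sub_pos.mpr ht.1) hpos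
    exact pos_of_mul_pos_right (hthree.trans_lt' (by linarith)) (sub_nonneg.mpr hs.1)

theorem trapezoid_le_integral (hab : a ≤ b) (hg : ConcaveOn ℝ (Set.Icc a b) g)
    (hint : IntervalIntegrable g MeasureTheory.volume a b) :
    (b - a) * (g a + g b) / 2 ≤ ∫ t in a..b, g t := by
  obtain ⟨α, hα⟩ : ∃ α, (b - a) * α = g b - g a := by
    rcases hab.eq_or_lt with rfl | hlt
    · exact ⟨0, by simp⟩
    · exact ⟨(g b - g a) / (b - a), mul_div_cancel₀ _ (sub_pos.mpr hlt).ne'⟩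
  calc (b - a) * (g a + g b) / 2 = ∫ t in a..b, (g a + (t - a) * α) := by
        rw [integral_affine, hα]
        ring
    _ ≤ ∫ t in a..b, g t := intervalIntegral.integral_mono_on hab
        (Continuous.intervalIntegrable (by fun_prop) _ _) hint
        fun t ht => chord_le_of_concaveOn hg ht hα

theorem trapezoid_add_trapezoid_le_integral {c : ℝ} (hc : c ∈ Set.Icc a b)
    (hg : ConcaveOn ℝ (Set.Icc a b) g) (hint : IntervalIntegrable g MeasureTheory.volume a b) :
    (c - a) * (g a + g c) / 2 + (b - c) * (g c + g b) / 2 ≤ ∫ t in a..b, g t := by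
  have hab := hc.1.trans hc.2
  have hintLeft : IntervalIntegrable g MeasureTheory.volume a c :=
    hint.mono_set (Set.uIcc_of_le hab ▸ Set.uIcc_of_le hc.1 ▸ Set.Icc_subset_Icc_right hc.2)
  have hintRight : IntervalIntegrable g MeasureTheory.volume c b :=
    hint.mono_set (Set.uIcc_of_le hab ▸ Set.uIcc_of_le hc.2 ▸ Set.Icc_subset_Icc_left hc.1)
  rw [← intervalIntegral.integral_add_adjacent_intervals hintLeft hintRight]
  exact add_le_add
    (trapezoid_le_integral hc.1 (hg.subset (Set.Icc_subset_Icc_right hc.2) (convex_Icc _ _))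
      hintLeft)
    (trapezoid_le_integral hc.2 (hg.subset (Set.Icc_subset_Icc_left hc.1) (convex_Icc _ _))
      hintRight)

end Concave

theorem card_le_integralCount {g : ℝ → ℝ} {a b : ℤ} {s : Finset ℤ} (hs : s ⊆ Finset.Ico a b)
    (hg : ∀ x ∈ s, g x ∈ Set.range ((↑) : ℤ → ℝ)) : s.card ≤ integralCount g a b := by
  classical
  exact Finset.card_le_card fun x hx => Finset.mem_filter.mpr ⟨hs hx, hg x hx⟩

theorem integralCount_le (g : ℝ → ℝ) {a b : ℤ} (hab : a ≤ b) :
    (integralCount g a b : ℤ) ≤ b - a := by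
  classical
  have hcard : integralCount g a b ≤ (Finset.Ico a b).card := Finset.card_filter_le _ _
  rw [Int.card_Ico] at hcard
  omega

/-- On `[a, b]`, `g` is the least concave function whose graph lies above the points of `V`; the
first coordinate is the abscissa. -/
structure IsUpperHull (V : Finset (Fin 2 → ℤ)) (a b : ℤ) (g : ℝ → ℝ) : Prop where
  lt : a < b
  concave : ConcaveOn ℝ (Set.Icc (a : ℝ) b) g
  mem : ∀ v ∈ V, v 0 ∈ Set.Icc a b
  le : ∀ v ∈ V, (v 1 : ℝ) ≤ g (v 0)
  least : ∀ α β : ℝ, (∀ v ∈ V, (v 1 : ℝ) ≤ α * v 0 + β) →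
    ∀ t ∈ Set.Icc (a : ℝ) b, g t ≤ α * t + β
  exists_left : ∃ v ∈ V, v 0 = a
  exists_right : ∃ v ∈ V, v 0 = b

namespace IsUpperHull

variable {V : Finset (Fin 2 → ℤ)} {a b : ℤ} {g : ℝ → ℝ}

theorem exists_vertex_above (h : IsUpperHull V a b g) {c d : ℤ} (hac : a ≤ c) (hcd : c < d)
    (hdb : d ≤ b) {α β : ℝ} (hc : g c = α * c + β) (hd : g d = α * d + β)
    (hV : ∃ v ∈ V, α * v 0 + β < (v 1 : ℝ)) : ∃ v ∈ V, v 0 ∈ Set.Ioo c d ∧ g (v 0) = v 1 := by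
  obtain ⟨w, hw, hwpos⟩ := hV
  obtain ⟨v, hv, hmax⟩ := V.exists_max_image (fun v => (v 1 : ℝ) - (α * v 0 + β)) ⟨w, hw⟩
  have hpos : α * v 0 + β < (v 1 : ℝ) := by linarith [hmax w hw]
  have hIcc {x : ℤ} (hx : x ∈ Set.Icc a b) : (x : ℝ) ∈ Set.Icc (a : ℝ) b :=
    ⟨Int.cast_le.mpr hx.1, Int.cast_le.mpr hx.2⟩
  have hgv : g (v 0) = v 1 := by
    refine le_antisymm ?_ (h.le v hv)
    have := h.least α (v 1 - α * v 0) (fun u hu => by linarith [hmax u hu]) _ (hIcc (h.mem v hv))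
    linarith
  have hcdR : (c : ℝ) < d := by exact_mod_cast hcd
  have hgap := mul_pos (sub_pos.mpr hcdR) (sub_pos.mpr hpos)
  refine ⟨v, hv, ⟨lt_of_not_ge fun hvc => ?_, lt_of_not_ge fun hdv => ?_⟩, hgv⟩
  · have hthree := three_point_of_concaveOn h.concave (hIcc (h.mem v hv))
      (hIcc ⟨hac.trans hcd.le, hdb⟩) (Int.cast_le.mpr hvc) hcdR.le
    rw [hc, hd, hgv] at hthree
    linarith
  · have hthree := three_point_of_concaveOn h.concave (hIcc ⟨hac, hcd.le.trans hdb⟩)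
      (hIcc (h.mem v hv)) hcdR.le (Int.cast_le.mpr hdv)
    rw [hc, hd, hgv] at hthree
    linarith

theorem eqOn_chord (h : IsUpperHull V a b g) {c d : ℤ} (hac : a ≤ c) (hdb : d ≤ b) {α : ℝ}
    (hα : (d - c) * α = g d - g c) (hV : ∀ v ∈ V, (v 1 : ℝ) ≤ α * v 0 + (g c - α * c)) :
    Set.EqOn (fun t => g c + (t - c) * α) g (Set.Icc c d) := fun t ht => by
  have hsubset : Set.Icc (c : ℝ) d ⊆ Set.Icc (a : ℝ) b :=
    Set.Icc_subset_Icc (Int.cast_le.mpr hac) (Int.cast_le.mpr hdb)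
  refine le_antisymm
    (chord_le_of_concaveOn (h.concave.subset hsubset (convex_Icc _ _)) ht hα) ?_
  linarith [h.least _ _ hV t (hsubset ht)]

/-- Between two integral points, either the hull is a chord or some vertex lies strictly between
them and splits it. -/
theorem hasFloorSum_of_int (h : IsUpperHull V a b g) {c d : ℤ} (hac : a ≤ c) (hcd : c < d)
    (hdb : d ≤ b) {y z : ℤ} (hc : g c = y) (hd : g d = z) : HasFloorSum g c d := by
  induction hk : (d - c).toNat using Nat.strong_induction_on generalizing c d y z with
  | _ k ih =>
  have hcdR : (d : ℝ) - c ≠ 0 := sub_ne_zero.mpr (by exact_mod_cast hcd.ne')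
  obtain ⟨α, hα⟩ : ∃ α : ℝ, (d - c) * α = g d - g c := ⟨_, mul_div_cancel₀ _ hcdR⟩
  by_cases hV : ∃ v ∈ V, α * v 0 + (g c - α * c) < (v 1 : ℝ)
  · obtain ⟨v, -, ⟨hcv, hvd⟩, hgv⟩ := h.exists_vertex_above hac hcd hdb (by ring)
      (by linarith) hV
    exact (ih _ (by omega) hac hcv (by omega) hc hgv rfl).trans hcv.le hvd.le
      (ih _ (by omega) (by omega) hvd hdb hgv hd rfl)
  · push Not at hV
    have heq := h.eqOn_chord hac hdb hα hV
    obtain ⟨q, rfl⟩ : ∃ q : ℕ, d = c + q := ⟨(d - c).toNat, by omega⟩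
    simp only [hc] at heq
    refine (HasFloorSum.affine y c (m := z - y) ?_).congr hcd.le heq
    rw [hc, hd] at hα
    push_cast at hα ⊢
    linarith

theorem exists_endpoint (h : IsUpperHull V a b g) {c : ℤ} (hc : ∃ v ∈ V, v 0 = c) {ε : ℤ}
    (hε : ∀ v ∈ V, v 0 ≠ c → 1 ≤ ε * (v 0 - c)) : ∃ y : ℤ, g c = y := by
  obtain ⟨w, hw, hwc⟩ := hc
  obtain ⟨v, hv, hvmax⟩ := (V.filter fun v => v 0 = c).exists_max_image (fun v => v 1)
    ⟨w, Finset.mem_filter.mpr ⟨hw, hwc⟩⟩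
  obtain ⟨hvV, hvc⟩ := Finset.mem_filter.mp hv
  obtain ⟨u, -, hu⟩ := V.exists_max_image (fun v => v 1) ⟨w, hw⟩
  have hline : ∀ z ∈ V, z 1 ≤ (ε * (u 1 - v 1)) * z 0 + (v 1 - ε * (u 1 - v 1) * c) := by
    intro z hz
    by_cases hzc : z 0 = c
    · have := hvmax z (Finset.mem_filter.mpr ⟨hz, hzc⟩)
      rw [hzc]
      linarith
    · nlinarith [hε z hz hzc, hu z hz, hu v hvV]
  refine ⟨v 1, le_antisymm ?_ (hvc ▸ h.le v hvV)⟩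
  obtain ⟨hac, hcb⟩ := hwc ▸ h.mem w hw
  have hleast := h.least (ε * (u 1 - v 1)) (v 1 - ε * (u 1 - v 1) * c)
    (fun z hz => by exact_mod_cast hline z hz) c
    ⟨Int.cast_le.mpr hac, Int.cast_le.mpr hcb⟩
  linarith

theorem exists_left_eq (h : IsUpperHull V a b g) : ∃ y : ℤ, g a = y :=
  h.exists_endpoint h.exists_left (ε := 1) fun v hv hva => by
    have := (h.mem v hv).1
    omega

theorem exists_right_eq (h : IsUpperHull V a b g) : ∃ y : ℤ, g b = y :=
  h.exists_endpoint h.exists_right (ε := -1) fun v hv hvb => by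
    have := (h.mem v hv).2
    omega

theorem hasFloorSum (h : IsUpperHull V a b g) : HasFloorSum g a b :=
  have ⟨_, hleft⟩ := h.exists_left_eq
  have ⟨_, hright⟩ := h.exists_right_eq
  h.hasFloorSum_of_int le_rfl h.lt le_rfl hleft hright

theorem one_le_integralCount (h : IsUpperHull V a b g) : 1 ≤ integralCount g a b := by
  refine card_le_integralCount (s := {a}) (by simpa using h.lt) fun x hx => ?_
  rw [Finset.mem_singleton.mp hx]
  exact h.exists_left_eq.imp fun _ => Eq.symm

theorem two_le_integralCount (h : IsUpperHull V a b g) {α β : ℝ} (ha : g a = α * a + β)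
    (hb : g b = α * b + β) (hV : ∃ v ∈ V, α * v 0 + β < (v 1 : ℝ)) :
    2 ≤ integralCount g a b := by
  obtain ⟨v, -, ⟨hav, hvb⟩, hgv⟩ := h.exists_vertex_above le_rfl h.lt le_rfl ha hb hV
  rw [← Finset.card_pair hav.ne]
  refine card_le_integralCount (fun x hx => ?_) fun x hx => ?_
  all_goals rcases Finset.mem_insert.mp hx with rfl | hx
  · exact Finset.left_mem_Ico.mpr h.lt
  · exact Finset.mem_singleton.mp hx ▸ Finset.mem_Ico.mpr ⟨hav.le, hvb⟩
  · exact h.exists_left_eq.imp fun _ => Eq.symm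
  · exact Finset.mem_singleton.mp hx ▸ ⟨v 1, hgv.symm⟩

end IsUpperHull

/-- The polygon spanned by `V` is the region between the graphs of `l` and `u` over `[a, b]`. -/
structure HasProfile (V : Finset (Fin 2 → ℤ)) (a b : ℤ) (l u : ℝ → ℝ) : Prop where
  lt : a < b
  le : ∀ t ∈ Set.Icc (a : ℝ) b, l t ≤ u t
  mem_iff : ∀ x : Fin 2 → ℝ,
    x ∈ latticeHull V ↔ x 0 ∈ Set.Icc (a : ℝ) b ∧ x 1 ∈ Set.Icc (l (x 0)) (u (x 0))

theorem exists_Icc_eq_image_inter_hyperplane {E : Type*} [AddCommGroup E] [Module ℝ E]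
    [TopologicalSpace E] {K : Set E} (hK : IsCompact K) (hconvex : Convex ℝ K)
    (f g : E →L[ℝ] ℝ) {t : ℝ} (ht : t ∈ f '' K) :
    ∃ l u, l ≤ u ∧ g '' (K ∩ {x | f x = t}) = Set.Icc l u := by
  obtain ⟨x, hx, hxt⟩ := ht
  have hcompact : IsCompact (g '' (K ∩ {x | f x = t})) :=
    (hK.inter_right (isClosed_eq f.continuous continuous_const)).image g.continuous
  have hconnected : IsConnected (g '' (K ∩ {x | f x = t})) :=
    ⟨⟨g x, x, ⟨hx, hxt⟩, rfl⟩, ((hconvex.inter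
      (convex_hyperplane f.isLinear t)).is_linear_image g.isLinear).isPreconnected⟩
  have hIcc := eq_Icc_of_connected_compact hconnected hcompact
  exact ⟨_, _, Set.nonempty_Icc.mp (hIcc ▸ hconnected.nonempty), hIcc⟩

theorem exists_mul_add_ne_of_polytopeDim_eq {V : Finset (Fin 2 → ℤ)}
    (hdim : polytopeDim (latticeHull V) = 2) (α β : ℝ) :
    ∃ v ∈ V, (v 1 : ℝ) ≠ α * v 0 + β := by
  have hne : (LinearMap.proj 1 - α • LinearMap.proj 0 : (Fin 2 → ℝ) →ₗ[ℝ] ℝ) ≠ 0 := fun h => by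
    simpa using LinearMap.congr_fun h ![0, 1]
  refine (exists_apply_ne_of_polytopeDim_eq hdim hne β).imp fun v hv => ⟨hv.1, fun h => hv.2 ?_⟩
  simp [intPoint, h]

theorem exists_hasProfile {V : Finset (Fin 2 → ℤ)}
    (hdim : polytopeDim (latticeHull V) = 2) : ∃ a b l u, HasProfile V a b l u := by
  have hproj : (LinearMap.proj 0 : (Fin 2 → ℝ) →ₗ[ℝ] ℝ) ≠ 0 := fun h => by
    simpa using LinearMap.congr_fun h ![1, 0]
  have hexists (c : ℝ) : ∃ v ∈ V, (v 0 : ℝ) ≠ c := exists_apply_ne_of_polytopeDim_eq hdim hproj c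
  obtain ⟨w, hw, -⟩ := hexists 0
  obtain ⟨p, hp, hmin⟩ := V.exists_min_image (fun v => v 0) ⟨w, hw⟩
  obtain ⟨q, hq, hmax⟩ := V.exists_max_image (fun v => v 0) ⟨w, hw⟩
  have himage : ∀ t ∈ Set.Icc (p 0 : ℝ) (q 0),
      t ∈ (ContinuousLinearMap.proj 0 : (Fin 2 → ℝ) →L[ℝ] ℝ) '' latticeHull V :=
    fun t ht => ((convex_convexHull ℝ _).is_linear_image
      (LinearMap.proj (R := ℝ) (φ := fun _ : Fin 2 => ℝ) 0).isLinear).ordConnected.out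
        (Set.mem_image_of_mem _ (intPoint_mem_latticeHull hp))
        (Set.mem_image_of_mem _ (intPoint_mem_latticeHull hq)) ht
  choose! l u hle hslice using fun t ht => exists_Icc_eq_image_inter_hyperplane
    (isCompact_latticeHull V) (convex_convexHull ℝ _) (.proj 0) (.proj 1) (himage t ht)
  refine ⟨p 0, q 0, l, u, ?_, hle, fun x => ⟨fun hx => ?_, fun ⟨hx0, hx1⟩ => ?_⟩⟩
  · obtain ⟨v, hv, hne⟩ := hexists (p 0)
    exact (lt_of_le_of_ne (hmin v hv) (by exact_mod_cast hne.symm)).trans_le (hmax v hv)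
  · have hx0 : x 0 ∈ Set.Icc (p 0 : ℝ) (q 0) :=
      ⟨neg_le_neg_iff.mp (le_of_mem_latticeHull (-LinearMap.proj 0)
        (fun v hv => neg_le_neg (Int.cast_le.mpr (hmin v hv))) hx),
      le_of_mem_latticeHull (LinearMap.proj 0) (fun v hv => Int.cast_le.mpr (hmax v hv)) hx⟩
    exact ⟨hx0, hslice _ hx0 ▸ ⟨x, ⟨hx, rfl⟩, rfl⟩⟩
  · rw [← hslice _ hx0] at hx1
    obtain ⟨y, ⟨hy, hy0⟩, hy1⟩ := hx1
    convert hy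
    ext i
    fin_cases i
    exacts [hy0.symm, hy1.symm]

namespace HasProfile

variable {V : Finset (Fin 2 → ℤ)} {a b : ℤ} {l u : ℝ → ℝ}

theorem mem_of_mem (h : HasProfile V a b l u) {v : Fin 2 → ℤ} (hv : v ∈ V) :
    (v 0 : ℝ) ∈ Set.Icc (a : ℝ) b ∧ (v 1 : ℝ) ∈ Set.Icc (l (v 0)) (u (v 0)) :=
  (h.mem_iff _).mp (intPoint_mem_latticeHull hv)

theorem mem_upper (h : HasProfile V a b l u) {t : ℝ} (ht : t ∈ Set.Icc (a : ℝ) b) :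
    ![t, u t] ∈ latticeHull V :=
  (h.mem_iff _).mpr ⟨ht, h.le t ht, le_rfl⟩

theorem upper (h : HasProfile V a b l u) : IsUpperHull V a b u where
  lt := h.lt
  concave := ⟨convex_Icc _ _, fun s hs t ht p q hp hq hpq => by
    have hmem := convex_convexHull ℝ _ (h.mem_upper hs) (h.mem_upper ht) hp hq hpq
    simpa using ((h.mem_iff _).mp hmem).2.2⟩
  mem v hv := by simpa using (h.mem_of_mem hv).1
  le v hv := (h.mem_of_mem hv).2.2
  least α β hV t ht := by
    have hle := le_of_mem_latticeHull (LinearMap.proj 1 - α • LinearMap.proj 0)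
      (fun v hv => by simpa [intPoint, add_comm] using hV v hv) (h.mem_upper ht) (c := β)
    simpa [add_comm] using hle
  exists_left := by
    obtain ⟨v, hv, hle⟩ := exists_le_apply_of_mem_latticeHull (-LinearMap.proj 0)
      (h.mem_upper ⟨le_rfl, Int.cast_le.mpr h.lt.le⟩)
    have hva : v 0 ≤ a := by simpa [intPoint] using hle
    exact ⟨v, hv, le_antisymm hva (by simpa using (h.mem_of_mem hv).1.1)⟩
  exists_right := by
    obtain ⟨v, hv, hle⟩ := exists_le_apply_of_mem_latticeHull (LinearMap.proj 0)
      (h.mem_upper ⟨Int.cast_le.mpr h.lt.le, le_rfl⟩)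
    have hbv : b ≤ v 0 := by simpa [intPoint] using hle
    exact ⟨v, hv, le_antisymm (by simpa using (h.mem_of_mem hv).1.2) hbv⟩

theorem reflect (h : HasProfile V a b l u) :
    HasProfile (V.image (!![1, 0; 0, -1] : Matrix _ _ ℤ).mulVec) a b
      (fun t => -u t) (fun t => -l t) where
  lt := h.lt
  le t ht := neg_le_neg (h.le t ht)
  mem_iff x := by
    have happly (y : Fin 2 → ℝ) :
        Matrix.toLin' ((!![1, 0; 0, -1] : Matrix _ _ ℤ).map ((↑) : ℤ → ℝ)) y =
          ![y 0, -y 1] := by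
      ext i
      fin_cases i <;> simp [Matrix.mulVec, dotProduct, Fin.sum_univ_two]
    rw [← toLin'_image_latticeHull]
    refine ⟨?_, fun ⟨hx0, hx1⟩ => ⟨![x 0, -x 1], (h.mem_iff _).mpr ⟨hx0, ?_⟩, ?_⟩⟩
    · rintro ⟨y, hy, rfl⟩
      obtain ⟨hy0, hy1⟩ := (h.mem_iff y).mp hy
      rw [happly]
      exact ⟨hy0, neg_le_neg hy1.2, neg_le_neg hy1.1⟩
    · exact ⟨le_neg_of_le_neg hx1.2, neg_le_of_neg_le hx1.1⟩
    · rw [happly]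
      ext i
      fin_cases i <;> simp

theorem lower (h : HasProfile V a b l u) :
    IsUpperHull (V.image (!![1, 0; 0, -1] : Matrix _ _ ℤ).mulVec) a b (fun t => -l t) :=
  h.reflect.upper

/-- If `l = u` throughout, concavity of `u` and `-l` would squeeze both onto the chord. -/
theorem exists_lt (h : HasProfile V a b l u) (hdim : polytopeDim (latticeHull V) = 2) :
    ∃ t ∈ Set.Icc (a : ℝ) b, l t < u t := by
  have hab : (b : ℝ) - a ≠ 0 := sub_ne_zero.mpr (by exact_mod_cast h.lt.ne')
  have hends : l a ≤ u a ∧ l b ≤ u b :=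
    ⟨h.le a ⟨le_rfl, Int.cast_le.mpr h.lt.le⟩, h.le b ⟨Int.cast_le.mpr h.lt.le, le_rfl⟩⟩
  by_contra! hle
  have heq (t : ℝ) (ht : t ∈ Set.Icc (a : ℝ) b) : l t = u t := (h.le t ht).antisymm (hle t ht)
  have ha := heq a ⟨le_rfl, Int.cast_le.mpr h.lt.le⟩
  have hb := heq b ⟨Int.cast_le.mpr h.lt.le, le_rfl⟩
  obtain ⟨α, hα⟩ : ∃ α, (b - a) * α = u b - u a := ⟨_, mul_div_cancel₀ _ hab⟩
  obtain ⟨v, hv, hne⟩ := exists_mul_add_ne_of_polytopeDim_eq hdim α (u a - a * α)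
  obtain ⟨hv0, hlv, hvu⟩ := h.mem_of_mem hv
  have hchordUpper := chord_le_of_concaveOn h.upper.concave hv0 hα
  have hchordLower := chord_le_of_concaveOn h.lower.concave hv0 (α := -α) (by linarith)
  exact hne (by linarith [heq _ hv0])

theorem lt_of_mem_Ioo (h : HasProfile V a b l u) (hdim : polytopeDim (latticeHull V) = 2) {t : ℝ}
    (ht : t ∈ Set.Ioo (a : ℝ) b) : l t < u t := by
  obtain ⟨s, hs, hlt⟩ := h.exists_lt hdim
  have hab := (ht.1.trans ht.2).le
  have hpos := pos_of_concaveOn (h.upper.concave.add h.lower.concave)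
    (le_add_neg_iff_le.mpr (h.le a ⟨le_rfl, hab⟩)) (le_add_neg_iff_le.mpr (h.le b ⟨hab, le_rfl⟩))
    hs (lt_add_neg_iff_lt.mpr hlt) ht
  exact lt_add_neg_iff_lt.mp hpos

end HasProfile

theorem cast_card_Icc_ceil_floor {x y : ℝ} (hxy : x ≤ y) :
    ((Finset.Icc ⌈x⌉ ⌊y⌋).card : ℝ) = midFloor y + midFloor (-x) := by
  have hle : ⌈x⌉ ≤ ⌊y⌋ + 1 := (Int.ceil_le_floor_add_one x).trans (by gcongr)
  rw [midFloor, midFloor, Int.floor_neg, Int.card_Icc, ← Int.cast_natCast,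
    Int.toNat_of_nonneg (sub_nonneg.mpr hle)]
  push_cast
  ring

theorem ncard_setOf_apply_mem (s : Finset ℤ) (F : ℤ → Finset ℤ) :
    {z : Fin 2 → ℤ | z 0 ∈ s ∧ z 1 ∈ F (z 0)}.ncard = ∑ x ∈ s, (F x).card := by
  have hset : {z : Fin 2 → ℤ | z 0 ∈ s ∧ z 1 ∈ F (z 0)} =
      ((s.sigma F).image fun p => ![p.1, p.2] : Finset (Fin 2 → ℤ)) := by
    ext z
    simp only [Set.mem_ofPred_eq, Finset.coe_image, Set.mem_image, Finset.mem_coe,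
      Finset.mem_sigma]
    refine ⟨fun hz => ⟨⟨z 0, z 1⟩, hz, List.ofFn_injective rfl⟩, ?_⟩
    rintro ⟨p, hp, rfl⟩
    exact hp
  rw [hset, Set.ncard_coe_finset, Finset.card_image_of_injective, Finset.card_sigma]
  rintro ⟨x, y⟩ ⟨x', y'⟩ hxy
  obtain rfl : x = x' := congrFun hxy 0
  obtain rfl : y = y' := congrFun hxy 1
  rfl

/-- The area of the region between the graphs of `l` and `u` over `[a, b]`; `-l` is kept in a
separate integral because it is an upper hull of the reflected polygon. -/
noncomputable def profileArea (a b : ℤ) (l u : ℝ → ℝ) : ℝ :=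
  (∫ t in (a : ℝ)..b, u t) + ∫ t in (a : ℝ)..b, -l t

/-- The total length of the two vertical sides of the region between the graphs of `l` and `u`
over `[a, b]`. -/
def verticalLength (a b : ℤ) (l u : ℝ → ℝ) : ℝ :=
  (u a - l a) + (u b - l b)

/-- The number of lattice points on the boundary of a lattice polygon with profile `l`, `u`. Each
integral point of the two graphs over `[a, b)` is counted once, and the vertical sides make up for
the remaining ones. -/
noncomputable def boundaryCount (a b : ℤ) (l u : ℝ → ℝ) : ℝ :=
  verticalLength a b l u + integralCount u a b + integralCount (fun t => -l t) a b

namespace HasProfile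

variable {V : Finset (Fin 2 → ℤ)} {a b : ℤ} {l u : ℝ → ℝ}

theorem latticePointCount_eq_sum (h : HasProfile V a b l u) {n : ℕ} (hn : 0 < n) :
    (latticePointCount (latticeHull V) n : ℝ) = ∑ x ∈ Finset.Icc (n * a) (n * b),
      (midFloor (n * u (x / n)) + midFloor (n * -l (x / n))) := by
  have hnR : (0 : ℝ) < n := by exact_mod_cast hn
  have hbase (x : ℤ) : x ∈ Finset.Icc (n * a) (n * b) ↔ (x / n : ℝ) ∈ Set.Icc (a : ℝ) b := by
    rw [Finset.mem_Icc, Set.mem_Icc, le_div_iff₀ hnR, div_le_iff₀ hnR, mul_comm (a : ℝ),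
      mul_comm (b : ℝ)]
    norm_cast
  have hcolumns : {z : Fin 2 → ℤ | intPoint z ∈ (n : ℝ) • latticeHull V} =
      {z | z 0 ∈ Finset.Icc (n * a) (n * b) ∧
        z 1 ∈ Finset.Icc ⌈n * l (z 0 / n)⌉ ⌊n * u (z 0 / n)⌋} := by
    ext z
    rw [Set.mem_ofPred_eq, Set.mem_smul_set_iff_inv_smul_mem₀ hnR.ne', h.mem_iff, Set.mem_ofPred_eq,
      hbase, Finset.mem_Icc, Int.ceil_le, Int.le_floor, ← le_div_iff₀' hnR, ← div_le_iff₀' hnR]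
    simp only [Pi.smul_apply, smul_eq_mul, inv_mul_eq_div]
    rfl
  rw [latticePointCount, hcolumns, ncard_setOf_apply_mem _ fun x =>
    Finset.Icc ⌈n * l (x / n)⌉ ⌊n * u (x / n)⌋, Nat.cast_sum]
  refine Finset.sum_congr rfl fun x hx => ?_
  rw [mul_neg]
  exact cast_card_Icc_ceil_floor
    (mul_le_mul_of_nonneg_left (h.le _ ((hbase x).mp hx)) hnR.le)

theorem latticePointCount_eq (h : HasProfile V a b l u) (n : ℕ) :
    (latticePointCount (latticeHull V) n : ℝ) =
      profileArea a b l u * n ^ 2 + boundaryCount a b l u / 2 * n + 1 := by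
  rcases n.eq_zero_or_pos with rfl | hn
  · rw [latticePointCount_zero ⟨_, h.mem_upper ⟨le_rfl, Int.cast_le.mpr h.lt.le⟩⟩]
    simp
  have hnR : (n : ℝ) ≠ 0 := by exact_mod_cast hn.ne'
  have hcolumn : midFloor (n * u ((n * b : ℤ) / n)) + midFloor (n * -l ((n * b : ℤ) / n)) =
      n * (u b - l b) + 1 := by
    obtain ⟨y, hy⟩ := h.upper.exists_right_eq
    obtain ⟨z, hz⟩ := h.lower.exists_right_eq
    have hb : ((n * b : ℤ) / n : ℝ) = b := by
      push_cast
      exact mul_div_cancel_left₀ _ hnR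
    rw [hb, sub_eq_add_neg, hy, hz]
    norm_cast
    rw [midFloor, midFloor, Int.floor_intCast, Int.floor_intCast]
    push_cast
    ring
  have hn0 : (0 : ℤ) ≤ n := by positivity
  rw [h.latticePointCount_eq_sum hn,
    ← Finset.sum_Ico_add_eq_sum_Icc (mul_le_mul_of_nonneg_left h.lt.le hn0),
    Finset.sum_add_distrib, h.upper.hasFloorSum.2, h.lower.hasFloorSum.2, hcolumn, profileArea,
    boundaryCount, verticalLength]
  ring

/-- Pick's theorem, with `i` the number of interior lattice points. -/
theorem exists_profileArea_eq (h : HasProfile V a b l u)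
    (hdim : polytopeDim (latticeHull V) = 2) :
    ∃ i : ℕ, profileArea a b l u = i + boundaryCount a b l u / 2 - 1 ∧ (b = a + 1 → i = 0) := by
  have hcolumn (x : ℤ) (hx : x ∈ Finset.Ioo a b) : ⌊l x⌋ + 1 ≤ ⌈u x⌉ := by
    obtain ⟨hax, hxb⟩ := Finset.mem_Ioo.mp hx
    exact Int.lt_ceil.mpr ((Int.floor_le _).trans_lt
      (h.lt_of_mem_Ioo hdim ⟨Int.cast_lt.mpr hax, Int.cast_lt.mpr hxb⟩))
  have hinterior : (∑ x ∈ Finset.Ioo a b, (⌈u x⌉ - ⌊l x⌋ - 1).toNat : ℝ) =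
      -∑ x ∈ Finset.Ioo a b, (midFloor (-u x) + midFloor (l x)) := by
    rw [← Finset.sum_neg_distrib]
    refine Finset.sum_congr rfl fun x hx => ?_
    rw [← Int.cast_natCast, Int.toNat_of_nonneg (by linarith [hcolumn x hx]), midFloor, midFloor,
      Int.floor_neg]
    push_cast
    ring
  have hcolumn_left : midFloor (-u a) + midFloor (l a) = 1 - (u a - l a) := by
    obtain ⟨y, hy⟩ := h.upper.exists_left_eq
    obtain ⟨z, hz⟩ := h.lower.exists_left_eq
    rw [show l a = (-z : ℤ) by push_cast; linarith, hy, ← Int.cast_neg, midFloor, midFloor,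
      Int.floor_intCast, Int.floor_intCast]
    push_cast
    ring
  refine ⟨∑ x ∈ Finset.Ioo a b, (⌈u x⌉ - ⌊l x⌋ - 1).toNat, ?_, ?_⟩
  · have hupper := h.upper.hasFloorSum.2 1
    have hlower := h.lower.hasFloorSum.2 1
    have hends := Finset.add_sum_Ioo_eq_sum_Ico
      (f := fun x : ℤ => midFloor (-u x) + midFloor (l x)) h.lt
    simp only [Nat.cast_one, one_mul, div_one, one_pow] at hupper hlower
    rw [Nat.cast_sum, hinterior, profileArea, boundaryCount, verticalLength]
    simp only [cast_integralCount, Finset.sum_add_distrib, neg_neg] at hupper hlower hends ⊢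
    linarith
  · rintro rfl
    exact Finset.sum_eq_zero fun x hx => absurd (Finset.mem_Ioo.mp hx) (by omega)

theorem exists_natCast_eq_verticalLength (h : HasProfile V a b l u) :
    ∃ q : ℕ, (q : ℝ) = verticalLength a b l u := by
  have hgap {c : ℤ} (hc : (c : ℝ) ∈ Set.Icc (a : ℝ) b) (hu : ∃ y : ℤ, u c = y)
      (hl : ∃ z : ℤ, -l c = z) : ∃ m : ℕ, (m : ℝ) = u c - l c := by
    obtain ⟨y, hy⟩ := hu
    obtain ⟨z, hz⟩ := hl
    have hnonneg : 0 ≤ y + z := by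
      have : (0 : ℝ) ≤ y + z := by linarith [h.le _ hc]
      exact_mod_cast this
    refine ⟨(y + z).toNat, ?_⟩
    rw [← Int.cast_natCast, Int.toNat_of_nonneg hnonneg, sub_eq_add_neg, hy, hz, Int.cast_add]
  have hab : (a : ℝ) ≤ b := Int.cast_le.mpr h.lt.le
  obtain ⟨m, hm⟩ := hgap ⟨le_rfl, hab⟩ h.upper.exists_left_eq h.lower.exists_left_eq
  obtain ⟨n, hn⟩ := hgap ⟨hab, le_rfl⟩ h.upper.exists_right_eq h.lower.exists_right_eq
  exact ⟨m + n, by rw [verticalLength, Nat.cast_add, hm, hn]⟩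

/-- Without vertical sides the two graphs share their end points, and a vertex off their common
chord contributes an extra integral point to one of them. -/
theorem three_le_boundaryCount (h : HasProfile V a b l u)
    (hdim : polytopeDim (latticeHull V) = 2) : 3 ≤ boundaryCount a b l u := by
  obtain ⟨q, hq⟩ := h.exists_natCast_eq_verticalLength
  rw [boundaryCount, ← hq]
  norm_cast
  have hupper := h.upper.one_le_integralCount
  have hlower := h.lower.one_le_integralCount
  rcases q.eq_zero_or_pos with rfl | hqpos
  · have hab : (a : ℝ) < b := Int.cast_lt.mpr h.lt
    have hgap_left := h.le a ⟨le_rfl, hab.le⟩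
    have hgap_right := h.le b ⟨hab.le, le_rfl⟩
    rw [verticalLength, Nat.cast_zero] at hq
    obtain ⟨α, hα⟩ : ∃ α, (b - a) * α = u b - u a :=
      ⟨_, mul_div_cancel₀ _ (sub_pos.mpr hab).ne'⟩
    obtain ⟨v, hv, hne⟩ := exists_mul_add_ne_of_polytopeDim_eq hdim α (u a - a * α)
    rcases hne.lt_or_gt with hbelow | habove
    · have htwo := h.lower.two_le_integralCount (α := -α) (β := a * α - u a) (by linarith)
        (by linarith) ⟨_, Finset.mem_image_of_mem _ hv, by
          simp only [Matrix.mulVec, dotProduct, Fin.sum_univ_two, Matrix.of_apply,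
            Matrix.cons_val_zero, Matrix.cons_val_one]
          push_cast
          linarith⟩
      omega
    · have htwo := h.upper.two_le_integralCount (by ring) (by linarith) ⟨v, hv, habove⟩
      omega
  · omega

theorem boundaryCount_le (h : HasProfile V a b l u) :
    boundaryCount a b l u ≤ verticalLength a b l u + 2 * (b - a) := by
  have hupper : (integralCount u a b : ℝ) ≤ b - a := by
    exact_mod_cast integralCount_le u h.lt.le
  have hlower : (integralCount (fun t => -l t) a b : ℝ) ≤ b - a := by
    exact_mod_cast integralCount_le (fun t => -l t) h.lt.le
  rw [boundaryCount]
  linarith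

end HasProfile

theorem exists_shear_offset {p s L R : ℝ} (hp : 0 < p) (hLR : R - L = s) (hs : 0 ≤ s)
    (hsp : s ≤ p) : ∃ k : ℤ, ∃ D ∈ Set.Icc L R, |D + k * p| ≤ (p - s) / 2 := by
  obtain ⟨k, hk⟩ : ∃ k : ℤ, |(L + R) / 2 + k * p| ≤ p / 2 := by
    refine ⟨-round ((L + R) / 2 / p), ?_⟩
    have hscale : (L + R) / 2 + (-round ((L + R) / 2 / p) : ℤ) * p =
        ((L + R) / 2 / p - round ((L + R) / 2 / p)) * p := by
      rw [sub_mul, div_mul_cancel₀ _ hp.ne', Int.cast_neg, neg_mul, sub_eq_add_neg]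
    rw [hscale, abs_mul, abs_of_pos hp]
    linarith [mul_le_mul_of_nonneg_right (abs_sub_round ((L + R) / 2 / p)) hp.le]
  obtain ⟨hlower, hupper⟩ := abs_le.mp hk
  refine ⟨k, ?_⟩
  rcases lt_or_ge (s / 2) ((L + R) / 2 + k * p) with hright | hright
  · exact ⟨L, ⟨le_rfl, by linarith⟩, abs_le.mpr ⟨by linarith, by linarith⟩⟩
  rcases lt_or_ge ((L + R) / 2 + k * p) (-(s / 2)) with hleft | hleft
  · exact ⟨R, ⟨by linarith, le_rfl⟩, abs_le.mpr ⟨by linarith, by linarith⟩⟩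
  · refine ⟨-(k * p), ⟨by linarith, by linarith⟩, ?_⟩
    rw [neg_add_cancel, abs_zero]
    linarith

namespace HasProfile

variable {V : Finset (Fin 2 → ℤ)} {a b : ℤ} {l u : ℝ → ℝ}

theorem trapezoid_le_area (h : HasProfile V a b l u) :
    (b - a) * verticalLength a b l u / 2 ≤ profileArea a b l u := by
  have hab : (a : ℝ) ≤ b := Int.cast_le.mpr h.lt.le
  have hupper := trapezoid_le_integral hab h.upper.concave h.upper.hasFloorSum.1
  have hlower := trapezoid_le_integral hab h.lower.concave h.lower.hasFloorSum.1
  rw [profileArea, verticalLength]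
  linarith

/-- The polygon contains the quadrilateral with vertices `v`, `w` and the end points of the
transversal `y = m + μ (t - a)`. -/
theorem transversal_le_area (h : HasProfile V a b l u) {m μ : ℝ}
    (ha : m ∈ Set.Icc (l a) (u a)) (hb : m + μ * (b - a) ∈ Set.Icc (l b) (u b))
    {v w : Fin 2 → ℤ} (hv : v ∈ V) (hw : w ∈ V) :
    (b - a) * (w 1 - v 1 - μ * (w 0 - v 0)) / 2 ≤ profileArea a b l u := by
  obtain ⟨⟨hav, hvb⟩, hlv, -⟩ := h.mem_of_mem hv
  obtain ⟨⟨haw, hwb⟩, -, hwu⟩ := h.mem_of_mem hw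
  have hupper := trapezoid_add_trapezoid_le_integral ⟨haw, hwb⟩ h.upper.concave
    h.upper.hasFloorSum.1
  have hlower := trapezoid_add_trapezoid_le_integral ⟨hav, hvb⟩ h.lower.concave
    h.lower.hasFloorSum.1
  rw [profileArea]
  have hab : (0 : ℝ) ≤ b - a := by linarith
  linarith [mul_le_mul_of_nonneg_left hwu hab, mul_le_mul_of_nonneg_left hlv hab,
    mul_le_mul_of_nonneg_left ha.2 (sub_nonneg.mpr haw),
    mul_le_mul_of_nonneg_left hb.2 (sub_nonneg.mpr hwb),
    mul_le_mul_of_nonneg_left ha.1 (sub_nonneg.mpr hav),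
    mul_le_mul_of_nonneg_left hb.1 (sub_nonneg.mpr hvb)]

/-- After a shear with a suitable `k`, some transversal joining the two vertical sides is nearly
horizontal, so a pair of vertices at large vertical distance gives a large quadrilateral. -/
theorem width_mul_le_area (h : HasProfile V a b l u) (hs : verticalLength a b l u ≤ b - a)
    (hwidth : ∀ k : ℤ, ∃ v ∈ V, ∃ w ∈ V, b - a ≤ (w 1 + k * w 0) - (v 1 + k * v 0)) :
    (b - a) * (b - a + verticalLength a b l u) / 4 ≤ profileArea a b l u := by
  have hab : (a : ℝ) < b := Int.cast_lt.mpr h.lt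
  have hp : (0 : ℝ) < b - a := sub_pos.mpr hab
  have hla := h.le a ⟨le_rfl, hab.le⟩
  have hlb := h.le b ⟨hab.le, le_rfl⟩
  obtain ⟨k, D, ⟨hDlower, hDupper⟩, hD⟩ := exists_shear_offset (L := l b - u a) (R := u b - l a)
    hp (s := verticalLength a b l u) (by rw [verticalLength]; ring)
    (by rw [verticalLength]; linarith) hs
  obtain ⟨v, hv, w, hw, hvw⟩ := hwidth k
  obtain ⟨μ, hμ⟩ : ∃ μ : ℝ, μ * (b - a) = D := ⟨_, div_mul_cancel₀ _ hp.ne'⟩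
  have hquadrilateral := h.transversal_le_area (m := max (l a) (l b - D)) (μ := μ)
    ⟨le_max_left _ _, max_le hla (by linarith)⟩
    (hμ ▸ ⟨sub_le_iff_le_add.mp (le_max_right _ _),
      le_sub_iff_add_le.mp (max_le (by linarith) (by linarith))⟩) hv hw
  obtain ⟨⟨hav, hvb⟩, -⟩ := h.mem_of_mem hv
  obtain ⟨⟨haw, hwb⟩, -⟩ := h.mem_of_mem hw
  have hheight : (b - a : ℝ) ≤ (w 1 + k * w 0) - (v 1 + k * v 0) := by exact_mod_cast hvw
  have hdistance : |(w 0 - v 0 : ℝ)| ≤ b - a := abs_le.mpr ⟨by linarith, by linarith⟩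
  have htilt : (μ + k) * (w 0 - v 0) ≤ (b - a - verticalLength a b l u) / 2 := by
    calc (μ + k) * (w 0 - v 0) ≤ |μ + k| * |(w 0 - v 0 : ℝ)| :=
          (le_abs_self _).trans_eq (abs_mul _ _)
      _ ≤ |μ + k| * (b - a) := mul_le_mul_of_nonneg_left hdistance (abs_nonneg _)
      _ = |D + k * (b - a)| := by rw [← hμ, ← add_mul, abs_mul, abs_of_pos hp]
      _ ≤ _ := hD
  have hscaled : (b - a) * ((b - a + verticalLength a b l u) / 2) ≤
      (b - a) * (w 1 - v 1 - μ * (w 0 - v 0)) :=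
    mul_le_mul_of_nonneg_left (by linarith) hp.le
  linarith

end HasProfile

section Scott

variable {V : Finset (Fin 2 → ℤ)}

/-- The unimodular map `(x, y) ↦ (y + c x, x)`. -/
def shearSwap (c : ℤ) : Matrix (Fin 2) (Fin 2) ℤ := !![c, 1; 1, 0]

theorem isUnit_det_shearSwap (c : ℤ) : IsUnit (shearSwap c).det := by
  simp [shearSwap, Matrix.det_fin_two]

theorem shearSwap_mulVec (c : ℤ) (v : Fin 2 → ℤ) :
    (shearSwap c).mulVec v = ![v 1 + c * v 0, v 0] := by
  ext i
  fin_cases i <;> simp [shearSwap, Matrix.mulVec, dotProduct, Fin.sum_univ_two, add_comm]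

theorem exists_hasProfile_width_le (hdim : polytopeDim (latticeHull V) = 2) :
    ∃ W a b l u, polytopeDim (latticeHull W) = 2 ∧
      latticePointCount (latticeHull W) = latticePointCount (latticeHull V) ∧
      HasProfile W a b l u ∧
      ∀ c : ℤ, ∃ v ∈ W, ∃ w ∈ W, b - a ≤ (w 1 + c * w 0) - (v 1 + c * v 0) := by
  obtain ⟨a, b, l, u, h⟩ := exists_hasProfile hdim
  induction hk : (b - a).toNat using Nat.strong_induction_on generalizing V a b l u with
  | _ k ih =>
  by_cases hwidth : ∀ c : ℤ, ∃ v ∈ V, ∃ w ∈ V, b - a ≤ (w 1 + c * w 0) - (v 1 + c * v 0)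
  · exact ⟨V, a, b, l, u, hdim, rfl, h, hwidth⟩
  push Not at hwidth
  obtain ⟨c, hc⟩ := hwidth
  have hembedding := isLatticeEmbedding_toLin' (isUnit_det_shearSwap c)
  have himage := toLin'_image_latticeHull (shearSwap c) V
  have hdim' : polytopeDim (latticeHull (V.image (shearSwap c).mulVec)) = 2 := by
    rw [← himage, hembedding.polytopeDim_image, hdim]
  obtain ⟨a', b', l', u', h'⟩ := exists_hasProfile hdim'
  have hsmaller : b' - a' < b - a := by
    obtain ⟨_, hvimage, rfl⟩ := h'.upper.exists_left
    obtain ⟨_, hwimage, rfl⟩ := h'.upper.exists_right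
    obtain ⟨v, hv, rfl⟩ := Finset.mem_image.mp hvimage
    obtain ⟨w, hw, rfl⟩ := Finset.mem_image.mp hwimage
    simpa only [shearSwap_mulVec, Matrix.cons_val_zero] using hc v hv w hw
  have hab := h.lt
  obtain ⟨W, a, b, l, u, hW, hcount, hprofile⟩ := ih _ (by omega) hdim' a' b' l' u' h' rfl
  refine ⟨W, a, b, l, u, hW, hcount.trans (funext fun n => ?_), hprofile⟩
  rw [← himage, hembedding.latticePointCount_image]

/-- Scott's inequality, from the two lower bounds for the area `A` of a polygon of width `p` with
`q` lattice units of vertical sides; the exception is the triangle `3Δ`. -/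
theorem boundary_le_of_width {A : ℝ} {k i q p : ℕ} (hA : A = i + k / 2 - 1)
    (hk : k ≤ q + 2 * p) (hi : i ≠ 0) (hp : 2 ≤ p) (htrapezoid : (p : ℝ) * q / 2 ≤ A)
    (hwidth : q ≤ p → (p : ℝ) * (p + q) / 4 ≤ A) : k ≤ 2 * i + 6 ∨ (k = 9 ∧ i = 1) := by
  have htrapezoid' : (p : ℤ) * q + 2 ≤ 2 * i + k := by
    have : (p : ℝ) * q + 2 ≤ 2 * i + k := by linarith
    exact_mod_cast this
  by_cases hlarge : p = 2 ∨ 4 ≤ q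
  · left
    zify at hk hp ⊢
    rcases hlarge with rfl | hq
    · push_cast at *
      linarith
    · zify at hq
      nlinarith
  push Not at hlarge
  obtain ⟨hp2, hq⟩ := hlarge
  by_cases hp3 : p = 3
  · omega
  have hp4 : 4 ≤ p := by omega
  have hwidth' : (p : ℤ) * (p + q) + 4 ≤ 4 * i + 2 * k := by
    have : (p : ℝ) * (p + q) + 4 ≤ 4 * i + 2 * k := by linarith [hwidth (by omega)]
    exact_mod_cast this
  left
  zify at hk hp4 ⊢
  nlinarith [sq_nonneg ((p : ℤ) - 4), mul_nonneg (sub_nonneg.mpr hp4) (Nat.cast_nonneg (α := ℤ) q)]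

/-- The Ehrhart polynomial of a lattice polygon with `i` interior and `k` boundary points. -/
noncomputable def pickPolynomial (i k : ℕ) : Polynomial ℂ :=
  .C (i + k / 2 - 1 : ℂ) * .X ^ 2 + .C (k / 2 : ℂ) * .X + 1

theorem eval_pickPolynomial (i k : ℕ) (z : ℂ) :
    (pickPolynomial i k).eval z = (i + k / 2 - 1) * z ^ 2 + k / 2 * z + 1 := by
  simp [pickPolynomial]

theorem HasProfile.boundary_le {a b : ℤ} {l u : ℝ → ℝ} (h : HasProfile V a b l u)
    (hwidth : ∀ k : ℤ, ∃ v ∈ V, ∃ w ∈ V, b - a ≤ (w 1 + k * w 0) - (v 1 + k * v 0))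
    {i k : ℕ} (hk : (k : ℝ) = boundaryCount a b l u)
    (hpick : profileArea a b l u = i + boundaryCount a b l u / 2 - 1)
    (hab : b = a + 1 → i = 0) (hi : i ≠ 0) : k ≤ 2 * i + 6 ∨ (k = 9 ∧ i = 1) := by
  have hlt := h.lt
  obtain ⟨q, hq⟩ := h.exists_natCast_eq_verticalLength
  obtain ⟨p, hp⟩ : ∃ p : ℕ, (p : ℤ) = b - a := ⟨(b - a).toNat, by omega⟩
  have hp2 : 2 ≤ p := by
    have : b ≠ a + 1 := mt hab hi
    omega
  have hpR : (p : ℝ) = b - a := by exact_mod_cast hp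
  have hboundary := h.boundaryCount_le
  have htrapezoid := h.trapezoid_le_area
  have hwide := h.width_mul_le_area (hwidth := hwidth)
  rw [← hk] at hpick hboundary
  rw [← hq, ← hpR] at hboundary htrapezoid hwide
  exact boundary_le_of_width hpick (by exact_mod_cast hboundary) hi hp2 htrapezoid
    fun hqp => hwide (by exact_mod_cast hqp)

theorem exists_pickPolynomial (hdim : polytopeDim (latticeHull V) = 2) :
    ∃ i k : ℕ, 3 ≤ k ∧ (i = 0 ∨ k ≤ 2 * i + 6 ∨ (k = 9 ∧ i = 1)) ∧
      IsEhrhartPolynomial (latticeHull V) (pickPolynomial i k) := by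
  obtain ⟨W, a, b, l, u, hW, hcount, h, hwidth⟩ := exists_hasProfile_width_le hdim
  obtain ⟨i, hpick, hab⟩ := h.exists_profileArea_eq hW
  obtain ⟨k, hk⟩ : ∃ k : ℕ, (k : ℝ) = boundaryCount a b l u := by
    obtain ⟨q, hq⟩ := h.exists_natCast_eq_verticalLength
    refine ⟨q + integralCount u a b + integralCount (fun t => -l t) a b, ?_⟩
    rw [boundaryCount, ← hq, Nat.cast_add, Nat.cast_add]
  refine ⟨i, k, ?_, or_iff_not_imp_left.mpr (h.boundary_le hwidth hk hpick hab), fun n => ?_⟩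
  · exact_mod_cast hk ▸ h.three_le_boundaryCount hW
  · have hn := h.latticePointCount_eq n
    rw [hcount, hpick, ← hk] at hn
    rw [eval_pickPolynomial, ← Complex.ofReal_natCast (latticePointCount _ n), hn]
    push_cast
    ring

end Scott

/-- The region of the complex plane that contains the roots of all Ehrhart polynomials of lattice
polygons. -/
def rootRegion : Set ℂ :=
  ({-2, -1, -2 / 3} : Set ℂ) ∪
    {w : ℂ | -1 / 2 ≤ w.re ∧ w.re < 0 ∧ |w.im| ≤ Real.sqrt 15 / 6}

theorem ofReal_mem_rootRegion {x : ℝ} (hle : -1 / 2 ≤ x) (hlt : x < 0) : (x : ℂ) ∈ rootRegion := by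
  refine Or.inr ⟨hle, hlt, ?_⟩
  rw [Complex.ofReal_im, abs_zero]
  positivity

theorem mem_rootRegion_of_isRoot_pickPolynomial_zero {k : ℕ} (hk : 3 ≤ k) {z : ℂ}
    (hz : (pickPolynomial 0 k).IsRoot z) : z ∈ rootRegion := by
  have hfactor : (z + 1) * ((k - 2) * z + 2) = 0 := by
    rw [Polynomial.IsRoot, eval_pickPolynomial, Nat.cast_zero] at hz
    linear_combination 2 * hz
  rcases mul_eq_zero.mp hfactor with hroot | hroot
  · exact Or.inl (Or.inr (Or.inl (eq_neg_of_add_eq_zero_left hroot)))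
  have hk2 : (0 : ℝ) < k - 2 := sub_pos.mpr (by exact_mod_cast hk)
  have hk2' : (k - 2 : ℂ) ≠ 0 := by exact_mod_cast hk2.ne'
  obtain rfl : z = (-2 / (k - 2) : ℝ) := by
    push_cast
    rw [eq_div_iff hk2']
    linear_combination hroot
  rcases lt_or_ge k 6 with hk6 | hk6
  · left
    interval_cases k <;> norm_num
  · have hk6R : (6 : ℝ) ≤ k := by exact_mod_cast hk6
    exact ofReal_mem_rootRegion ((le_div_iff₀ hk2).mpr (by linarith))
      (div_neg_of_neg_of_pos (by norm_num) hk2)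

section Quadratic

variable {A B : ℝ}

/-- Both the vertex `-B / (2 * A)` and, by `hval`, the roots lie to the right of `-1 / 2`. -/
theorem neg_half_le_of_quadratic_eq_zero (hA : 0 < A) (hBA : B ≤ A) (hval : 0 ≤ A / 4 - B / 2 + 1)
    {x : ℝ} (hx : A * x ^ 2 + B * x + 1 = 0) : -1 / 2 ≤ x := by
  by_contra! hlt
  have hslope : 0 < A * (1 / 2 - x) - B := by nlinarith
  have hincrement : 0 < (-1 / 2 - x) * (A * (1 / 2 - x) - B) :=
    mul_pos (sub_pos.mpr hlt) hslope
  linarith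

theorem neg_of_quadratic_eq_zero (hA : 0 ≤ A) (hB : 0 ≤ B) {x : ℝ}
    (hx : A * x ^ 2 + B * x + 1 = 0) : x < 0 := by
  by_contra! hnonneg
  have hsquare : 0 ≤ A * x ^ 2 := by positivity
  have hlinear : 0 ≤ B * x := by positivity
  linarith

/-- A nonreal root `z` satisfies `2 * A * z.re = -B` and `A * ‖z‖ ^ 2 = 1`. -/
theorem mem_rootRegion_of_im_ne_zero (hB : 3 / 2 ≤ B) (hBA : B ≤ A) {z : ℂ} (him : z.im ≠ 0)
    (hz : (A : ℂ) * z ^ 2 + B * z + 1 = 0) : z ∈ rootRegion := by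
  have hA : 0 < A := by linarith
  have hre : 2 * A * z.re = -B := by
    have h := congrArg Complex.im hz
    simp only [pow_two, Complex.add_im, Complex.mul_im, Complex.ofReal_re, Complex.ofReal_im,
      Complex.mul_re, zero_mul, add_zero, Complex.one_im, Complex.zero_im] at h
    refine mul_right_cancel₀ him ?_
    linear_combination h
  have hnorm : A * (z.re ^ 2 + z.im ^ 2) = 1 := by
    have h := congrArg Complex.re hz
    simp only [pow_two, Complex.add_re, Complex.mul_re, Complex.ofReal_re, Complex.ofReal_im,
      Complex.mul_im, zero_mul, sub_zero, Complex.one_re, Complex.zero_re] at h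
    linear_combination z.re * hre - h
  refine Or.inr ⟨by nlinarith, by nlinarith, abs_le_of_sq_le_sq ?_ (by positivity)⟩
  rw [div_pow, Real.sq_sqrt (by norm_num)]
  have hdiscriminant : (2 * A) ^ 2 * z.im ^ 2 = 4 * A - B ^ 2 := by
    linear_combination 4 * A * hnorm - (2 * A * z.re - B) * hre
  refine le_of_mul_le_mul_left (a := (2 * A) ^ 2) ?_ (by positivity)
  nlinarith [mul_nonneg (sub_nonneg.mpr (hB.trans hBA)) (by linarith : 0 ≤ A - 9 / 10)]

end Quadratic

theorem mem_rootRegion_of_isRoot_pickPolynomial {i k : ℕ} (hk : 3 ≤ k)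
    (hscott : i = 0 ∨ k ≤ 2 * i + 6 ∨ (k = 9 ∧ i = 1)) {z : ℂ}
    (hz : (pickPolynomial i k).IsRoot z) : z ∈ rootRegion := by
  rcases i.eq_zero_or_pos with rfl | hi
  · exact mem_rootRegion_of_isRoot_pickPolynomial_zero hk hz
  have hkR : (3 : ℝ) ≤ k := by exact_mod_cast hk
  have hiR : (1 : ℝ) ≤ i := by exact_mod_cast hi
  have hquadratic : ((i + k / 2 - 1 : ℝ) : ℂ) * z ^ 2 + (k / 2 : ℝ) * z + 1 = 0 := by
    rw [Polynomial.IsRoot, eval_pickPolynomial] at hz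
    push_cast
    exact hz
  by_cases him : z.im = 0
  · obtain ⟨x, rfl⟩ : ∃ x : ℝ, z = x := ⟨z.re, Complex.ext rfl him⟩
    norm_cast at hquadratic
    have hneg := neg_of_quadratic_eq_zero (by linarith) (by positivity) hquadratic
    rcases hscott with rfl | hle | ⟨rfl, rfl⟩
    · exact absurd hi (lt_irrefl 0)
    · have hleR : (k : ℝ) ≤ 2 * i + 6 := by exact_mod_cast hle
      exact ofReal_mem_rootRegion (neg_half_le_of_quadratic_eq_zero (by linarith) (by linarith)
        (by linarith) hquadratic) hneg
    · have hfactor : (x + 2 / 3) * (x + 1 / 3) = 0 := by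
        norm_num1 at hquadratic
        linarith
      rcases mul_eq_zero.mp hfactor with hroot | hroot
      · obtain rfl : x = -2 / 3 := by linarith
        simp [rootRegion]
      · exact ofReal_mem_rootRegion (by linarith) hneg
  · exact mem_rootRegion_of_im_ne_zero (by linarith) (by linarith) him hquadratic

theorem IsEhrhartPolynomial.unique {d : ℕ} {P : Set (Fin d → ℝ)} {p q : Polynomial ℂ}
    (hp : IsEhrhartPolynomial P p) (hq : IsEhrhartPolynomial P q) : p = q :=
  Polynomial.eq_of_infinite_eval_eq p q <|
    (Set.infinite_range_of_injective (Nat.cast_injective (R := ℂ))).mono <|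
      Set.range_subset_iff.mpr fun n => (hp n).trans (hq n).symm

theorem theorem2p2 {d : ℕ} (P : Set (Fin d → ℝ)) (hP : IsLatticePolytope P)
    (hdim : polytopeDim P = 2) :
    (∃! p : Polynomial ℂ, IsEhrhartPolynomial P p) ∧
      ∀ p : Polynomial ℂ, IsEhrhartPolynomial P p → ∀ z : ℂ, p.IsRoot z →
        z ∈ ({-2, -1, -2 / 3} : Set ℂ) ∪
          {w : ℂ | -1 / 2 ≤ w.re ∧ w.re < 0 ∧ |w.im| ≤ Real.sqrt 15 / 6} := by
  have hne : P.Nonempty := by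
    by_contra hempty
    obtain rfl := Set.not_nonempty_iff_eq_empty.mp hempty
    rw [polytopeDim, vectorSpan_empty, finrank_bot] at hdim
    exact two_ne_zero hdim.symm
  obtain ⟨V, hV, hcount⟩ :
      ∃ V : Finset (Fin 2 → ℤ), polytopeDim (latticeHull V) = 2 ∧
        latticePointCount (latticeHull V) = latticePointCount P :=
    hdim ▸ hP.exists_latticeHull_latticePointCount_eq hne
  obtain ⟨i, k, hk, hscott, hV⟩ := exists_pickPolynomial hV
  have hpick : IsEhrhartPolynomial P (pickPolynomial i k) := fun n => hcount ▸ hV n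
  refine ⟨⟨_, hpick, fun _ hp => hp.unique hpick⟩, fun p hp z hz => ?_⟩
  exact mem_rootRegion_of_isRoot_pickPolynomial hk hscott (hp.unique hpick ▸ hz)
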